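/- Let $n\ge 2$ be an integer and write $[k]=\{1,\dots,k\}$ (so $[0]=\varnothing$). An operation $F\colon [k]^n\to[k]$ is *associative* if $$F(x_1,\dots,x_{i-1},F(x_i,\dots,x_{i+n-1}),x_{i+n},\dots,x_{2n-1})=F(x_1,\dots,x_i,F(x_{i+1},\dots,x_{i+n}),x_{i+n+1},\dots,x_{2n-1})$$ for all $x_1,\dots,x_{2n-1}\in[k]$ and all $1\le i\le n-1$; it is *quasitrivial* if $F(x_1,\dots,x_n)\in\{x_1,\dots,x_n\}$ for all $x_1,\dots,x_n\in[k]$. An element $e\in[k]$ is *neutral* for $F$ if $F(e,\dots,e,x,e,\dots,e)=x$ for all $x\in[k]$ and every position of $x$ among the $n$ arguments. Let $q^n(k)$ be the number of associative and quasitrivial operations $F\colon[k]^n\to[k]$ ($k\ge 0$), and for $m\in\{0,1,2\}$ let $q^n_m(k)$ be the number of those that have exactly $m$ neutral elements ($k\ge 1$). In particular $q^2(k)$ and $q^2_1(k)$ count the associative and quasitrivial binary operations on $[k]$, and those among them that have exactly one neutral element. For every integer $k\ge 1$, $$q^n_1(k)=q^2_1(k)\qquad\text{and}\qquad q^n_0(k)=q^2(k)-q^2_1(k).$$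 For every integer $k\ge 2$, $$q^n_2(k)=\begin{cases}0 & \text{if } n \text{ is even},\\ \binom{k}{2}\,q^2(k-2) & \text{if } n \text{ is odd,}\end{cases}\qquad q^n(k)=\begin{cases}q^2(k) & \text{if } n \text{ is even},\\ q^2(k)+\binom{k}{2}\,q^2(k-2) & \text{if } n \text{ is odd.}\end{cases}$$ -/

import Mathlib

namespace NaryOp

/-- For an `n`-ary operation `F`, a tuple `x` of length `2n-1` and a position `i` (counted from `0`),
the composite `F(x_0,…,x_{i-1}, F(x_i,…,x_{i+n-1}), x_{i+n},…,x_{2n-2})`. -/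
def nest {X : Type*} {n : ℕ} (F : (Fin n → X) → X) (x : Fin (2 * n - 1) → X) (i : Fin n) : X :=
  F fun j =>
    if j < i then x ⟨j, by omega⟩
    else if j = i then F fun l => x ⟨i + l, by omega⟩
    else x ⟨j + (n - 1), by omega⟩

/-- Associativity of an `n`-ary operation: the inner application of `F` may be moved from any
position to the next one. -/
def IsAssociative {X : Type*} {n : ℕ} (F : (Fin n → X) → X) : Prop :=
  ∀ (x : Fin (2 * n - 1) → X) (i : ℕ) (hi : i + 1 < n),
    nest F x ⟨i, Nat.lt_of_succ_lt hi⟩ = nest F x ⟨i + 1, hi⟩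

/-- Quasitriviality: `F(x_1,…,x_n) ∈ {x_1,…,x_n}`. -/
def IsQuasitrivial {X : Type*} {n : ℕ} (F : (Fin n → X) → X) : Prop :=
  ∀ x : Fin n → X, F x ∈ Set.range x

/-- `e` is neutral for `F`: `F(e,…,e,a,e,…,e) = a` for all `a` and all positions of `a`. -/
def IsNeutral {X : Type*} {n : ℕ} (F : (Fin n → X) → X) (e : X) : Prop :=
  ∀ (a : X) (i : Fin n), F (Function.update (fun _ => e) i a) = a

/-- `q^n(k)`: the number of associative and quasitrivial `n`-ary operations on a `k`-element set. -/
noncomputable def q (n k : ℕ) : ℕ :=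
  Nat.card {F : (Fin n → Fin k) → Fin k // IsAssociative F ∧ IsQuasitrivial F}

/-- `q^n_m(k)`: the number of associative and quasitrivial `n`-ary operations on a `k`-element set
that have exactly `m` neutral elements. -/
noncomputable def qNeutral (n m k : ℕ) : ℕ :=
  Nat.card {F : (Fin n → Fin k) → Fin k //
    IsAssociative F ∧ IsQuasitrivial F ∧ {e : Fin k | IsNeutral F e}.ncard = m}

end NaryOp

/-! Put n = m + 1. An associative F is the n-fold product inside a monoid containing X
(`IsAssociative.exists_isMonoidRep`), so the problem concerns a subset S of a monoid in which every
(m+1)-fold product is one of its factors. Then x^(m+1) = x on S, and xy is x² or y² unless x² = y²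
(`IsQuasitrivialSet.mul_eq_or`).

If squaring is injective on S, the rule ab = G(a,b)² defines an associative quasitrivial binary G, F
is the iterate of G, and F has at most one neutral element. If x² = y² for some x ≠ y, then m is
even, x and y are exactly the neutral elements of F, and every other z satisfies zx = xz = z². In
that case a binary H governs the remaining elements, and F is the iterate of H extended by the pair,
viewed as a copy of ℤ/2 acting trivially (`extOp`).

Conversely, for even m every such extension has a quasitrivial iterate. The binary operation is
recovered from F by evaluating at (a, b, …, b), so both descriptions are bijective. Operations with
at most one neutral element therefore match binary ones, and those with two are given by a pair and
a binary operation on the other k − 2 elements. -/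

namespace NaryOp
variable {X : Type*} {n : ℕ}

/-! ### Word evaluation and the embedding into a monoid -/

/-- Evaluate a word by repeatedly applying `F` to its first `n` letters. Words whose length is not
of the form `1 + t (n - 1)` have no value. -/
def evalWord (hn : 2 ≤ n) (F : (Fin n → X) → X) (l : List X) : Option X :=
  if h : n ≤ l.length then evalWord hn F (F (fun i => l[i]) :: l.drop n)
  else if l.length = 1 then l.head? else none
termination_by l.length
decreasing_by simp; omega

theorem evalWord_append (hn : 2 ≤ n) (F : (Fin n → X) → X) (w : Fin n → X) (v : List X) :
    evalWord hn F (List.ofFn w ++ v) = evalWord hn F (F w :: v) := by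
  rw [evalWord, dif_pos (by simp)]
  congr 2
  · congr 1; ext i; simp
  · simp

theorem exists_ofFn_append {l : List X} (h : n ≤ l.length) :
    ∃ (w : Fin n → X) (v : List X), l = List.ofFn w ++ v :=
  ⟨fun i => l[i], l.drop n, by
    have : (List.ofFn fun i : Fin n => l[i]) = l.take n := by
      apply List.ext_getElem <;> simp [h]
    rw [this, List.take_append_drop]⟩

theorem evalWord_eq_none (hn : 2 ≤ n) (F : (Fin n → X) → X) {l : List X} (h : l.length < n)
    (h1 : l.length ≠ 1) : evalWord hn F l = none := by
  rw [evalWord, dif_neg (by omega), if_neg h1]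

theorem evalWord_singleton (hn : 2 ≤ n) (F : (Fin n → X) → X) (a : X) :
    evalWord hn F [a] = some a := by
  rw [evalWord, dif_neg (by simp; omega)]; simp

theorem IsAssociative.nest_eq {F : (Fin n → X) → X} (hF : IsAssociative F) (x : Fin (2 * n - 1) → X)
    (i : ℕ) (hi : i < n) : nest F x ⟨i, hi⟩ = nest F x ⟨0, by omega⟩ := by
  induction i with
  | zero => rfl
  | succ i ih => rw [← hF x i hi, ih]

/-- Rephrases `nest` through concatenation of words, so that later arguments avoid index arithmetic.
-/
theorem nest_eq_of_append {F : (Fin n → X) → X} {x : Fin (2 * n - 1) → X} {u v : List X}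
    {w : Fin n → X} (hx : List.ofFn x = u ++ List.ofFn w ++ v) (hu : u.length < n)
    {y : Fin n → X} (hy : List.ofFn y = u ++ F w :: v) : nest F x ⟨u.length, hu⟩ = F y := by
  have hx' : ∀ (i : ℕ) (hi : i < 2 * n - 1),
      x ⟨i, hi⟩ = (u ++ (List.ofFn w ++ v))[i]'(by rw [← List.append_assoc, ← hx]; simpa) := by
    intro i hi; simp [← List.append_assoc, ← hx]
  have hy' : ∀ (i : ℕ) (hi : i < n), y ⟨i, hi⟩ = (u ++ F w :: v)[i]'(by rw [← hy]; simpa) := by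
    intro i hi; simp [← hy]
  unfold nest
  congr 1
  ext ⟨j, hj⟩
  rw [hy']
  have hw : (fun l : Fin n => x ⟨u.length + l, by omega⟩) = w := by
    ext l
    rw [hx', List.getElem_append_right (by omega),
      List.getElem_append_left (by simp)]
    simp
  simp only [Fin.mk_lt_mk, Fin.mk.injEq]
  split_ifs with h1 h2
  · rw [hx', List.getElem_append_left h1, List.getElem_append_left h1]
  · subst h2
    rw [hw]; simp
  · rw [hx', List.getElem_append_right (by omega),
      List.getElem_append_right (by rw [List.length_ofFn]; omega),
      List.getElem_append_right (by omega), List.getElem_cons, dif_neg (by omega)]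
    congr 1
    simp; omega

/-- This is generalized associativity: contracting any block of n consecutive letters preserves the
value. A long prefix shortens by evaluating its first n letters. With a short prefix, associativity
on a window of 2n − 1 letters moves the contraction to the front. -/
theorem IsAssociative.evalWord_subst (hn : 2 ≤ n) {F : (Fin n → X) → X} (hF : IsAssociative F)
    (w : Fin n → X) (u v : List X) :
    evalWord hn F (u ++ List.ofFn w ++ v) = evalWord hn F (u ++ F w :: v) := by
  induction hk : u.length using Nat.strong_induction_on generalizing u with
  | _ k ih =>
    subst hk
    by_cases hu : n ≤ u.length
    · obtain ⟨w', u', rfl⟩ := exists_ofFn_append hu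
      simp only [List.append_assoc]
      rw [evalWord_append, evalWord_append]
      have := ih (F w' :: u').length (by simp at hu ⊢; omega) (F w' :: u') rfl
      simpa using this
    · by_cases hl : n ≤ (u ++ F w :: v).length
      -- The part `v₁` completes the contracted word to exactly n letters, so `u`, `w`, `v₁`
      -- together have 2n − 1.
      · obtain ⟨v₁, v₂, hv₁, rfl⟩ : ∃ v₁ v₂, (u ++ F w :: v₁).length = n ∧ v = v₁ ++ v₂ :=
          ⟨v.take (n - 1 - u.length), v.drop (n - 1 - u.length), by simp at hl ⊢; omega, by simp⟩
        obtain ⟨y, r, hy⟩ := exists_ofFn_append hv₁.ge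
        have hr : r = [] := by
          have := congrArg List.length hy
          rw [hv₁] at this
          simpa using this
        rw [hr, List.append_nil] at hy
        have hlen : (u ++ List.ofFn w ++ v₁).length = 2 * n - 1 := by simp at hv₁ ⊢; omega
        obtain ⟨x, r, hx⟩ := exists_ofFn_append hlen.ge
        have hr : r = [] := by
          have := congrArg List.length hx
          rw [hlen] at this
          simpa using this
        rw [hr, List.append_nil] at hx
        obtain ⟨w₀, v₀, hx₀⟩ := exists_ofFn_append (n := n) (l := List.ofFn x) (by simp; omega)
        obtain ⟨y₀, r, hy₀⟩ := exists_ofFn_append (n := n) (l := F w₀ :: v₀) (by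
          have := congrArg List.length hx₀
          simp at this ⊢; omega)
        have hr : r = [] := by
          have := congrArg List.length hx₀
          have := congrArg List.length hy₀
          simp at *
          exact List.length_eq_zero_iff.1 (by omega)
        rw [hr, List.append_nil] at hy₀
        have h1 := nest_eq_of_append (F := F) hx.symm (by omega) hy.symm
        have h2 := nest_eq_of_append (F := F) (u := []) hx₀ (by simp; omega) hy₀.symm
        rw [hF.nest_eq] at h1
        have h3 : F y = F y₀ := h1.symm.trans h2
        calc evalWord hn F (u ++ List.ofFn w ++ (v₁ ++ v₂))
            = evalWord hn F (List.ofFn w₀ ++ (v₀ ++ v₂)) := by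
              rw [← List.append_assoc, hx, hx₀, List.append_assoc]
          _ = evalWord hn F (List.ofFn y₀ ++ v₂) := by
              rw [evalWord_append, ← hy₀, List.cons_append]
          _ = evalWord hn F (List.ofFn y ++ v₂) := by rw [evalWord_append, evalWord_append, h3]
          _ = evalWord hn F (u ++ F w :: (v₁ ++ v₂)) := by rw [← hy]; simp
      · rcases Nat.eq_zero_or_pos (u.length + v.length) with h0 | h0
        · obtain rfl : u = [] := List.length_eq_zero_iff.1 (by omega)
          obtain rfl : v = [] := List.length_eq_zero_iff.1 (by omega)
          simpa using evalWord_append hn F w []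
        -- The contracted word has fewer than n letters but not just one, so both sides have no
        -- value.
        · rw [evalWord_eq_none hn F (l := u ++ F w :: v) (by omega) (by simp; omega)]
          obtain ⟨w', v', hw'⟩ := exists_ofFn_append (n := n) (l := u ++ List.ofFn w ++ v)
            (by simp; omega)
          have := congrArg List.length hw'
          simp only [List.length_append, List.length_ofFn, List.length_cons] at this hl
          rw [hw', evalWord_append, evalWord_eq_none] <;> rw [List.length_cons] <;> omega

/-- The syntactic congruence of a function on words. -/
def syntacticCon {α β : Type*} (f : List α → β) : Con (FreeMonoid α) where
  r u v := ∀ p q : FreeMonoid α, f (p * u * q).toList = f (p * v * q).toList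
  iseqv := ⟨fun _ _ _ => rfl, fun h p q => (h p q).symm, fun h h' p q => (h p q).trans (h' p q)⟩
  mul' {a b c d} h h' p q := by
    have h1 := h p (c * q)
    have h2 := h' (p * b) q
    simp only [mul_assoc] at h1 h2 ⊢
    rw [h1, h2]

/-- `ι` embeds `X` into a monoid in such a way that `F` becomes the `n`-fold product. -/
structure IsMonoidRep {X M : Type*} [Monoid M] {n : ℕ} (F : (Fin n → X) → X) (ι : X → M) : Prop where
  injective : Function.Injective ι
  map_apply : ∀ x, ι (F x) = ((List.ofFn x).map ι).prod

/-- The monoid is the syntactic monoid of `evalWord`. The empty context separates letters, and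
`evalWord_subst` says exactly that a block of n letters is congruent to its value. -/
theorem IsAssociative.exists_isMonoidRep {X : Type} (hn : 2 ≤ n) {F : (Fin n → X) → X}
    (hF : IsAssociative F) : ∃ (M : Type) (_ : Monoid M) (ι : X → M), IsMonoidRep F ι := by
  let c := syntacticCon (evalWord hn F)
  refine ⟨c.Quotient, inferInstance, fun a => (FreeMonoid.of a : c.Quotient), ?_, ?_⟩
  · intro a b hab
    have h := (Con.eq c).1 hab 1 1
    simpa [evalWord_singleton, FreeMonoid.toList_of] using h
  · intro x
    have h1 : ((List.ofFn x).map fun a => (FreeMonoid.of a : c.Quotient)).prod =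
        ((FreeMonoid.ofList (List.ofFn x) : FreeMonoid X) : c.Quotient) := by
      induction List.ofFn x with
      | nil => rfl
      | cons a l ih =>
        rw [List.map_cons, List.prod_cons, ih, FreeMonoid.ofList_cons, Con.coe_mul]
    rw [h1]
    refine ((Con.eq c).2 fun p q => ?_).symm
    have := hF.evalWord_subst hn x p.toList q.toList
    simpa [FreeMonoid.toList_mul, FreeMonoid.toList_of] using this

theorem IsMonoidRep.map_nest {M : Type*} [Monoid M] {F : (Fin n → X) → X} {ι : X → M}
    (h : IsMonoidRep F ι) (x : Fin (2 * n - 1) → X) (i : Fin n) :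
    ι (nest F x i) = ((List.ofFn x).map ι).prod := by
  obtain ⟨i, hi⟩ := i
  let l := List.ofFn x
  have hl : l.length = 2 * n - 1 := by simp [l]
  have hw : (List.ofFn fun j : Fin n => l[i + j]'(by omega)) = (l.drop i).take n := by
    apply List.ext_getElem <;> simp; omega
  have hy : List.ofFn (fun j : Fin n => (l.take i ++
      F (fun j : Fin n => l[i + j]'(by omega)) :: l.drop (i + n))[j]'(by simp; omega)) =
      l.take i ++ F (fun j : Fin n => l[i + j]'(by omega)) :: l.drop (i + n) := by
    apply List.ext_getElem <;> simp; omega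
  have hx : List.ofFn x = l.take i ++ List.ofFn (fun j : Fin n => l[i + j]'(by omega)) ++
      l.drop (i + n) := by
    rw [hw, List.append_assoc, ← List.drop_drop, List.take_append_drop, List.take_append_drop]
  have hi' : (l.take i).length = i := by simp; omega
  have := nest_eq_of_append hx (by rw [hi']; exact hi) hy
  simp only [hi'] at this
  rw [this, h.map_apply, hy]
  conv_rhs => rw [hx]
  simp [h.map_apply]

theorem IsMonoidRep.isAssociative {M : Type*} [Monoid M] {F : (Fin n → X) → X} {ι : X → M}
    (h : IsMonoidRep F ι) : IsAssociative F := fun x i hi =>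
  h.injective (by rw [h.map_nest, h.map_nest])


/-! ### Sets whose (m+1)-fold products are quasitrivial -/

/-- Every product of `n` elements of `S` is one of the factors. -/
def IsQuasitrivialSet {M : Type*} [Monoid M] (n : ℕ) (S : Set M) : Prop :=
  ∀ w : List M, w.length = n → (∀ a ∈ w, a ∈ S) → w.prod ∈ w

namespace IsQuasitrivialSet

variable {M : Type*} [Monoid M] {m : ℕ} {S : Set M} {x y z : M}

theorem op (hS : IsQuasitrivialSet m S) : IsQuasitrivialSet m (MulOpposite.unop ⁻¹' S) := by
  intro w hw hwS
  have h := hS (w.map MulOpposite.unop).reverse (by simpa using hw) (by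
    intro a ha
    obtain ⟨b, hb, rfl⟩ := List.mem_map.1 (List.mem_reverse.1 ha)
    exact hwS b hb)
  rw [← MulOpposite.unop_list_prod, List.mem_reverse, List.mem_map] at h
  obtain ⟨b, hb, h⟩ := h
  rwa [← MulOpposite.unop_injective h]

theorem pow_succ_eq (hS : IsQuasitrivialSet (m + 1) S) (hx : x ∈ S) : x ^ (m + 1) = x := by
  have h := hS (List.replicate (m + 1) x) (by simp) (by simp [hx])
  rw [List.prod_replicate] at h
  exact List.eq_of_mem_replicate h

theorem pow_mul_add_one (hS : IsQuasitrivialSet (m + 1) S) (hx : x ∈ S) (t : ℕ) :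
    x ^ (m * t + 1) = x := by
  induction t with
  | zero => simp
  | succ t ih =>
    rw [show m * (t + 1) + 1 = m + (m * t + 1) by ring, pow_add, ih, ← pow_succ,
      hS.pow_succ_eq hx]

theorem pow_mul_pow (hS : IsQuasitrivialSet m S) (hx : x ∈ S) (hy : y ∈ S) {i j : ℕ}
    (hij : i + j = m) : x ^ i * y ^ j = x ∨ x ^ i * y ^ j = y := by
  have h := hS (List.replicate i x ++ List.replicate j y) (by simpa using hij) (by
    intro a ha
    rcases List.mem_append.1 ha with h | h <;> rw [List.eq_of_mem_replicate h] <;> assumption)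
  rw [List.prod_append, List.prod_replicate, List.prod_replicate] at h
  rcases List.mem_append.1 h with h | h
  · exact .inl (List.eq_of_mem_replicate h)
  · exact .inr (List.eq_of_mem_replicate h)

/-- Follow x^i y^(m+1-i), which is x or y, as i grows. A change from x to y between neighbouring
exponents forces x² = y². Otherwise either x y^m = y, giving xy = y², or the value stays x up to x^m
y, giving xy = x². -/
theorem mul_eq_or (hm : 1 ≤ m) (hS : IsQuasitrivialSet (m + 1) S) (hx : x ∈ S) (hy : y ∈ S) :
    x * y = x * x ∨ x * y = y * y ∨ x * x = y * y := by
  by_cases hne : x * x = y * y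
  · exact .inr (.inr hne)
  have key : ∀ i j, i + 1 + j = m → x * y ^ m = x → x ^ (i + 1) * y ^ (j + 1) = x := by
    intro i
    induction i with
    | zero =>
      intro j hj h
      rwa [zero_add, pow_one, show j + 1 = m by omega]
    | succ i ih =>
      intro j hj h
      have h1 := ih (j + 1) (by omega) h
      rcases hS.pow_mul_pow hx hy (i := i + 1 + 1) (j := j + 1) (by omega) with h2 | h2
      · exact h2
      · refine absurd ?_ hne
        calc x * x = x * (x ^ (i + 1) * y ^ (j + 1 + 1)) := by rw [h1]
          _ = (x ^ (i + 1 + 1) * y ^ (j + 1)) * y := by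
            rw [pow_succ' x (i + 1), pow_succ y (j + 1)]; simp only [mul_assoc]
          _ = y * y := by rw [h2]
  rcases hS.pow_mul_pow hx hy (i := 1) (j := m) (by omega) with h | h
  · rw [pow_one] at h
    have h1 := key (m - 1) 0 (by omega) h
    rw [Nat.sub_add_cancel hm, zero_add, pow_one] at h1
    left
    calc x * y = x ^ (m + 1) * y := by rw [hS.pow_succ_eq hx]
      _ = x * (x ^ m * y) := by rw [pow_succ', mul_assoc]
      _ = x * x := by rw [h1]
  · rw [pow_one] at h
    right; left
    calc x * y = x * y ^ (m + 1) := by rw [hS.pow_succ_eq hy]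
      _ = (x * y ^ m) * y := by rw [pow_succ, mul_assoc]
      _ = y * y := by rw [h]

theorem pow_mul_of_mul_eq_left (h : x * y = x * x) (i : ℕ) : x ^ (i + 1) * y = x ^ (i + 2) := by
  rw [pow_succ, mul_assoc, h, ← mul_assoc, ← pow_succ, ← pow_succ]

theorem mul_pow_of_mul_eq_right (h : x * y = y * y) (i : ℕ) : x * y ^ (i + 1) = y ^ (i + 2) := by
  rw [pow_succ', ← mul_assoc, h, mul_assoc, ← pow_succ', ← pow_succ']

theorem pow_mul_of_mul_eq_right (h : x * y = y * y) (i : ℕ) : x ^ i * y = y ^ (i + 1) := by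
  induction i with
  | zero => simp
  | succ i ih => rw [pow_succ', mul_assoc, ih, mul_pow_of_mul_eq_right h]

theorem mul_pow_of_mul_eq_left (h : x * y = x * x) (i : ℕ) : x * y ^ i = x ^ (i + 1) := by
  induction i with
  | zero => simp
  | succ i ih => rw [pow_succ, ← mul_assoc, ih, pow_mul_of_mul_eq_left h]

/-- Equality of powers passes to the next exponent, since multiplying by the other element merely
raises the exponent. It thus reaches m(i+1) + 1, where both powers collapse to x and y. -/
theorem eq_of_pow_eq (hS : IsQuasitrivialSet (m + 1) S) (hm : 1 ≤ m) (hx : x ∈ S) (hy : y ∈ S)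
    (hxy : x * y = x * x ∨ x * y = y * y) {i : ℕ} (h : x ^ (i + 1) = y ^ (i + 1)) : x = y := by
  have key : ∀ j, x ^ (i + 1 + j) = y ^ (i + 1 + j) := by
    intro j
    induction j with
    | zero => exact h
    | succ j ih =>
      rcases hxy with hxy | hxy
      · have := pow_mul_of_mul_eq_left hxy (i + j)
        rw [show i + j + 1 = i + 1 + j by ring, ih, ← pow_succ] at this
        rw [← add_assoc, this]; congr 1; ring
      · have := mul_pow_of_mul_eq_right hxy (i + j)
        rw [show i + j + 1 = i + 1 + j by ring, ← ih, ← pow_succ'] at this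
        rw [← add_assoc, this]; congr 1; ring
  have h1 := key (m * (i + 1) - i)
  have h2 : i ≤ m * (i + 1) := by nlinarith
  rw [show i + 1 + (m * (i + 1) - i) = m * (i + 1) + 1 by omega, hS.pow_mul_add_one hx,
    hS.pow_mul_add_one hy] at h1
  exact h1

section SquareEq

variable (hm : 1 ≤ m) (hS : IsQuasitrivialSet (m + 1) S) (hx : x ∈ S) (hy : y ∈ S)
  (hxy : x ≠ y) (h2 : x * x = y * y)
include hm hS hx hy hxy h2

theorem mul_ne_of_sq_eq : x * y ≠ x * x := fun h =>
  hxy (hS.eq_of_pow_eq hm hx hy (.inl h) (i := 1) (by simpa [pow_two] using h2))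

omit hm in
theorem even_of_sq_eq : Even m := by
  by_contra hodd
  obtain ⟨t, ht⟩ := (Nat.not_even_iff_odd.1 hodd).add_one
  apply hxy
  rw [← hS.pow_succ_eq hx, ← hS.pow_succ_eq hy, ht, ← two_mul, pow_mul, pow_mul, pow_two, pow_two,
    h2]

omit hm in
theorem pow_eq_of_sq_eq : x ^ m = y ^ m := by
  obtain ⟨t, ht⟩ := hS.even_of_sq_eq hx hy hxy h2
  rw [ht, ← two_mul, pow_mul, pow_mul, pow_two, pow_two, h2]

/-- The product x y x^(m-1) is x or y. Since y x^m = y, multiplying by x on the right gives xy, so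
xy is x² (excluded) or yx. -/
theorem comm_of_sq_eq : x * y = y * x := by
  obtain ⟨t, ht⟩ : ∃ t, m = t + 2 := by
    obtain ⟨s, hs⟩ := hS.even_of_sq_eq hx hy hxy h2
    exact ⟨m - 2, by omega⟩
  have hxm : y * x ^ m = y := by
    rw [hS.pow_eq_of_sq_eq hx hy hxy h2, ← pow_succ', hS.pow_succ_eq hy]
  have h := hS (x :: y :: List.replicate (t + 1) x) (by simp [ht]) (by
    intro a ha
    simp only [List.mem_cons, List.mem_replicate] at ha
    rcases ha with rfl | rfl | ⟨-, rfl⟩ <;> assumption)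
  have h' : x * (y * x ^ (t + 1)) = x ∨ x * (y * x ^ (t + 1)) = y := by
    simp only [List.prod_cons, List.prod_replicate, List.mem_cons, List.mem_replicate] at h
    tauto
  have h3 : x * (y * x ^ (t + 1)) * x = x * y := by
    rw [mul_assoc, mul_assoc, ← pow_succ, ← ht, hxm]
  rcases h' with h' | h'
  · rw [h'] at h3
    exact absurd h3.symm (hS.mul_ne_of_sq_eq hm hx hy hxy h2)
  · rw [h'] at h3
    exact h3.symm

/-- If three elements shared a square, their common m-th power would fix all of them, allowing
cancellation. Then x y z^(m-1) could be none of its factors: multiplying by z gives xy, which would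
equal xz, yz or z². -/
theorem sq_ne_of_sq_eq (hz : z ∈ S) (hzx : z ≠ x) (hzy : z ≠ y) : z * z ≠ x * x := by
  intro h
  obtain ⟨t, ht⟩ : ∃ t, m = t + 2 := by
    obtain ⟨s, hs⟩ := hS.even_of_sq_eq hx hy hxy h2
    exact ⟨m - 2, by omega⟩
  have hxz : x ^ m * z = z := by
    rw [← hS.pow_eq_of_sq_eq hz hx hzx h, ← pow_succ, hS.pow_succ_eq hz]
  have hxy' : x ^ m * y = y := by
    rw [hS.pow_eq_of_sq_eq hx hy hxy h2, ← pow_succ, hS.pow_succ_eq hy]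
  have hyz : y * z ^ m = y := by
    rw [hS.pow_eq_of_sq_eq hz hy hzy (h.trans h2), ← pow_succ', hS.pow_succ_eq hy]
  have hw := hS (x :: y :: List.replicate (t + 1) z) (by simp [ht]) (by
    intro a ha
    simp only [List.mem_cons, List.mem_replicate] at ha
    rcases ha with rfl | rfl | ⟨-, rfl⟩ <;> assumption)
  have hw' : x * (y * z ^ (t + 1)) = x ∨ x * (y * z ^ (t + 1)) = y ∨ x * (y * z ^ (t + 1)) = z := by
    simp only [List.prod_cons, List.prod_replicate, List.mem_cons, List.mem_replicate] at hw
    tauto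
  have h3 : x * (y * z ^ (t + 1)) * z = x * y := by
    rw [mul_assoc, mul_assoc, ← pow_succ, ← ht, hyz]
  have cancel : ∀ {u v}, x ^ m * u = u → x ^ m * v = v → x * u = x * v → u = v := by
    intro u v hu hv huv
    rw [← hu, ← hv, ht, pow_succ, mul_assoc, huv, ← mul_assoc]
  rcases hw' with h' | h' | h' <;> rw [h'] at h3
  · exact hzy (cancel hxz hxy' h3)
  · rw [hS.comm_of_sq_eq hm hx hy hxy h2] at h3
    have hcancel : ∀ u v, y ^ m * u = u → y ^ m * v = v → y * u = y * v → u = v := by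
      intro u v hu hv huv
      rw [← hu, ← hv, ht, pow_succ, mul_assoc, huv, ← mul_assoc]
    refine hzx (hcancel z x ?_ ?_ h3)
    · rw [← hS.pow_eq_of_sq_eq hx hy hxy h2, hxz]
    · rw [← hS.pow_eq_of_sq_eq hx hy hxy h2, ← pow_succ, hS.pow_succ_eq hx]
  · exact hS.mul_ne_of_sq_eq hm hx hy hxy h2 (h3.symm.trans h)

theorem mul_left_eq_of_sq_eq (hz : z ∈ S) (hzx : z ≠ x) (hzy : z ≠ y) : z * x = z * z := by
  rcases hS.mul_eq_or hm hz hx with h | h | h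
  · exact h
  · exfalso
    -- With zx = x², the alternatives for zy collapse in turn: zy = z² gives x³ = z³, and zy = y²
    -- gives x = z^(m-1) y² = y.
    rcases hS.mul_eq_or hm hz hy with h' | h' | h'
    · have h3 : z * (x * x) = z * (y * y) := by rw [h2]
      rw [← pow_two, ← pow_two, mul_pow_of_mul_eq_left h' 2, mul_pow_of_mul_eq_right h 1] at h3
      exact hzx (hS.eq_of_pow_eq hm hz hx (.inr h) (i := 2) h3.symm)
    · have hx' := pow_mul_of_mul_eq_right h m
      have hy' := pow_mul_of_mul_eq_right h' m
      obtain ⟨t, rfl⟩ : ∃ t, m = t + 1 := ⟨m - 1, by omega⟩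
      rw [hS.pow_succ_eq hx, pow_succ, mul_assoc, h, h2] at hx'
      rw [hS.pow_succ_eq hy, pow_succ, mul_assoc, h'] at hy'
      exact hxy (hx'.symm.trans hy')
    · exact hS.sq_ne_of_sq_eq hm hx hy hxy h2 hz hzx hzy (h'.trans h2.symm)
  · exact absurd h (hS.sq_ne_of_sq_eq hm hx hy hxy h2 hz hzx hzy)

theorem mul_right_eq_of_sq_eq (hz : z ∈ S) (hzx : z ≠ x) (hzy : z ≠ y) : x * z = z * z := by
  have := hS.op.mul_left_eq_of_sq_eq (x := .op x) (y := .op y) (z := .op z) hm (by simpa)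
    (by simpa) (by simpa) (by simpa using congrArg MulOpposite.op h2) (by simpa) (by simpa)
    (by simpa)
  simpa using congrArg MulOpposite.unop this

end SquareEq

end IsQuasitrivialSet

/-! ### Binary operations and their iterates -/

theorem isAssociative_two {X : Type*} {G : (Fin 2 → X) → X}
    (h : ∀ a b c, G ![G ![a, b], c] = G ![a, G ![b, c]]) : IsAssociative G := by
  intro x i hi
  obtain rfl : i = 0 := by omega
  have h1 : nest G x ⟨0, by omega⟩ = G ![G ![x ⟨0, by omega⟩, x ⟨1, by omega⟩], x ⟨2, by omega⟩] := by
    unfold nest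
    congr 1
    ext j
    fin_cases j
    · simp only [Fin.zero_eta, lt_self_iff_false, if_false, if_true, Matrix.cons_val_zero]
      congr 1
      ext l
      fin_cases l <;> rfl
    · rfl
  have h2 : nest G x ⟨1, by omega⟩ = G ![x ⟨0, by omega⟩, G ![x ⟨1, by omega⟩, x ⟨2, by omega⟩]] := by
    unfold nest
    congr 1
    ext j
    fin_cases j
    · rfl
    · simp only [Fin.mk_one, lt_self_iff_false, if_false, if_true, Matrix.cons_val_one]
      congr 1
      ext l
      fin_cases l <;> rfl
  exact h1.trans ((h _ _ _).trans h2.symm)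

theorem isQuasitrivial_two {X : Type*} {G : (Fin 2 → X) → X}
    (h : ∀ a b, G ![a, b] = a ∨ G ![a, b] = b) : IsQuasitrivial G := by
  intro x
  have hx : x = ![x 0, x 1] := by ext i; fin_cases i <;> rfl
  rcases h (x 0) (x 1) with h' | h'
  · exact ⟨0, by rw [← h', ← hx]⟩
  · exact ⟨1, by rw [← h', ← hx]⟩

theorem IsQuasitrivial.apply_two {X : Type*} {G : (Fin 2 → X) → X} (h : IsQuasitrivial G)
    (a b : X) : G ![a, b] = a ∨ G ![a, b] = b := by
  obtain ⟨i, hi⟩ := h ![a, b]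
  fin_cases i
  · exact .inl hi.symm
  · exact .inr hi.symm

/-- The `(m + 1)`-ary operation obtained by iterating a binary operation. -/
def iterOp {X : Type*} (m : ℕ) (G : (Fin 2 → X) → X) : (Fin (m + 1) → X) → X := fun x =>
  (List.ofFn (Fin.tail x)).foldl (fun a b => G ![a, b]) (x 0)

theorem IsQuasitrivial.iterOp {X : Type*} (m : ℕ) {G : (Fin 2 → X) → X} (h : IsQuasitrivial G) :
    IsQuasitrivial (iterOp m G) := by
  have key : ∀ (l : List X) a, l.foldl (fun a b => G ![a, b]) a ∈ a :: l := by
    intro l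
    induction l with
    | nil => simp
    | cons b l ih =>
      intro a
      have := ih (G ![a, b])
      rw [List.foldl_cons]
      rcases h.apply_two a b with h' | h' <;> rw [h'] at this ⊢ <;>
        simp only [List.mem_cons] at this ⊢ <;> tauto
  intro x
  have := key (List.ofFn (Fin.tail x)) (x 0)
  have hx : x 0 :: List.ofFn (Fin.tail x) = List.ofFn x := by rw [List.ofFn_succ]; rfl
  rwa [hx, List.mem_ofFn] at this

/-! ### Iterates and neutral elements inside the monoid -/

namespace IsMonoidRep

variable {X M : Type*} [Monoid M] {ι : X → M} {m : ℕ}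

theorem map_apply_two {G : (Fin 2 → X) → X} (h : IsMonoidRep G ι) (a b : X) :
    ι (G ![a, b]) = ι a * ι b := by
  simp [h.map_apply]

theorem map_foldl {G : (Fin 2 → X) → X} (h : IsMonoidRep G ι) (l : List X) (a : X) :
    ι (l.foldl (fun a b => G ![a, b]) a) = ι a * (l.map ι).prod := by
  induction l generalizing a with
  | nil => simp
  | cons b l ih =>
    rw [List.foldl_cons, ih, h.map_apply_two, List.map_cons, List.prod_cons, mul_assoc]

theorem iterOp (m : ℕ) {G : (Fin 2 → X) → X} (h : IsMonoidRep G ι) :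
    IsMonoidRep (iterOp m G) ι where
  injective := h.injective
  map_apply x := by
    rw [NaryOp.iterOp, h.map_foldl, List.ofFn_succ, List.map_cons, List.prod_cons]
    rfl

theorem isQuasitrivialSet {n : ℕ} {F : (Fin n → X) → X} (h : IsMonoidRep F ι)
    (hF : IsQuasitrivial F) : IsQuasitrivialSet n (Set.range ι) := by
  intro w hw hwS
  obtain ⟨l, rfl⟩ : ∃ l : List X, l.map ι = w := by
    have : w ∈ Set.range (List.map ι) := by rw [Set.range_list_map]; exact hwS
    exact this
  obtain ⟨x, v, hx⟩ := exists_ofFn_append (n := n) (l := l) (by simpa using hw.ge)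
  have hv : v = [] := by
    have := congrArg List.length hx
    rw [List.length_map] at hw
    rw [List.length_append, List.length_ofFn, hw] at this
    exact List.length_eq_zero_iff.1 (by omega)
  rw [hv, List.append_nil] at hx
  rw [hx, ← h.map_apply]
  obtain ⟨i, hi⟩ := hF x
  exact List.mem_map_of_mem ((List.mem_ofFn' _ _).2 ⟨i, hi⟩)

theorem map_update {F : (Fin (m + 1) → X) → X} (h : IsMonoidRep F ι) (a e : X)
    (i : Fin (m + 1)) :
    ι (F (Function.update (fun _ => e) i a)) = ι e ^ (i : ℕ) * ι a * ι e ^ (m - i) := by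
  have : List.ofFn (Function.update (fun _ => e) i a) =
      List.replicate i e ++ a :: List.replicate (m - i) e := by
    apply List.ext_getElem
    · simp; omega
    · intro j h1 h2
      simp only [List.getElem_ofFn, Function.update_apply, Fin.ext_iff]
      rcases lt_trichotomy j i with h | h | h
      · rw [if_neg (by omega), List.getElem_append_left (by simpa), List.getElem_replicate]
      · rw [if_pos h, List.getElem_append_right (by simp; omega)]
        simp [h]
      · rw [if_neg (by omega), List.getElem_append_right (by simp; omega), List.getElem_cons,
          dif_neg (by simp; omega), List.getElem_replicate]
  rw [h.map_apply, this]
  simp [mul_assoc]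

theorem isNeutral_iff {F : (Fin (m + 1) → X) → X} (h : IsMonoidRep F ι) {e : X} :
    IsNeutral F e ↔ ∀ a i j, i + j = m → ι e ^ i * ι a * ι e ^ j = ι a := by
  constructor
  · intro H a i j hij
    have := h.map_update a e ⟨i, by omega⟩
    rw [H, Fin.val_mk, show m - i = j by omega] at this
    exact this.symm
  · intro H a i
    apply h.injective
    rw [h.map_update, H]
    exact Nat.add_sub_cancel' (Nat.lt_succ_iff.1 i.isLt)

theorem isNeutral_iterOp_iff (hm : 1 ≤ m) {G : (Fin 2 → X) → X} (h : IsMonoidRep G ι)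
    (hG : IsQuasitrivial G) {e : X} : IsNeutral (NaryOp.iterOp m G) e ↔ IsNeutral G e := by
  have he : ι e * ι e = ι e := by
    rw [← h.map_apply_two]
    rcases hG.apply_two e e with h' | h' <;> rw [h']
  have hpow : ∀ j, 1 ≤ j → ι e ^ j = ι e := by
    intro j hj
    induction j, hj using Nat.le_induction with
    | base => simp
    | succ j _ ih => rw [pow_succ, ih, he]
  rw [(h.iterOp m).isNeutral_iff, IsMonoidRep.isNeutral_iff (m := 1) h]
  constructor
  · intro H a i j hij
    rcases (by omega : (i = 0 ∧ j = 1) ∨ (i = 1 ∧ j = 0)) with ⟨rfl, rfl⟩ | ⟨rfl, rfl⟩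
    · simpa [hpow m hm] using H a 0 m (by omega)
    · simpa [hpow m hm] using H a m 0 (by omega)
  · intro H a i j hij
    have h1 := H a 0 1 rfl
    have h2 := H a 1 0 rfl
    simp at h1 h2
    have h3 : ∀ i, ι e ^ i * ι a = ι a := by
      intro i
      induction i with
      | zero => simp
      | succ i ih => rw [pow_succ, mul_assoc, h2, ih]
    have h4 : ∀ i, ι a * ι e ^ i = ι a := by
      intro i
      induction i with
      | zero => simp
      | succ i ih => rw [pow_succ', ← mul_assoc, h1, ih]
    rw [h3, h4]

variable {F : (Fin (m + 1) → X) → X}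

/-- If the squares differed, say de = d², then d^m e = d^(m+1) = d, whereas neutrality of d makes it
e. -/
theorem sq_eq_of_isNeutral (hm : 1 ≤ m) (h : IsMonoidRep F ι) (hF : IsQuasitrivial F) {d e : X}
    (hd : IsNeutral F d) (he : IsNeutral F e) (hde : d ≠ e) : ι d * ι d = ι e * ι e := by
  have hS := h.isQuasitrivialSet hF
  rcases hS.mul_eq_or hm (Set.mem_range_self d) (Set.mem_range_self e) with h' | h' | h'
  · have h1 := h.isNeutral_iff.1 hd e m 0 (by omega)
    obtain ⟨t, rfl⟩ : ∃ t, m = t + 1 := ⟨m - 1, by omega⟩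
    rw [pow_zero, mul_one, IsQuasitrivialSet.pow_mul_of_mul_eq_left h',
      hS.pow_succ_eq (Set.mem_range_self d)] at h1
    exact absurd (h.injective h1) hde
  · have h1 := h.isNeutral_iff.1 he d 0 m (by omega)
    obtain ⟨t, rfl⟩ : ∃ t, m = t + 1 := ⟨m - 1, by omega⟩
    rw [pow_zero, one_mul, IsQuasitrivialSet.mul_pow_of_mul_eq_right h',
      hS.pow_succ_eq (Set.mem_range_self e)] at h1
    exact absurd (h.injective h1).symm hde
  · exact h'

/-- The element ι d commutes with all of the image, so only ι d ^ m acting as the identity remains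
to be checked. -/
theorem isNeutral_of_sq_eq (hm : 1 ≤ m) (h : IsMonoidRep F ι) (hF : IsQuasitrivial F) {d e : X}
    (hde : d ≠ e) (h2 : ι d * ι d = ι e * ι e) : IsNeutral F d := by
  have hS := h.isQuasitrivialSet hF
  have hd := Set.mem_range_self (f := ι) d
  have he := Set.mem_range_self (f := ι) e
  have hne := h.injective.ne hde
  rw [h.isNeutral_iff]
  intro a i j hij
  have ha := Set.mem_range_self (f := ι) a
  have comm : Commute (ι d) (ι a) := by
    by_cases had : a = d
    · rw [had]
    by_cases hae : a = e
    · rw [hae]; exact hS.comm_of_sq_eq hm hd he hne h2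
    · exact (hS.mul_right_eq_of_sq_eq hm hd he hne h2 ha (h.injective.ne had)
        (h.injective.ne hae)).trans (hS.mul_left_eq_of_sq_eq hm hd he hne h2 ha
        (h.injective.ne had) (h.injective.ne hae)).symm
  rw [mul_assoc, ← (comm.pow_left j).eq, ← mul_assoc, ← pow_add, hij]
  by_cases had : a = d
  · rw [had, ← pow_succ, hS.pow_succ_eq hd]
  by_cases hae : a = e
  · rw [hae, hS.pow_eq_of_sq_eq hd he hne h2, ← pow_succ, hS.pow_succ_eq he]
  · have := hS.mul_right_eq_of_sq_eq hm hd he hne h2 ha (h.injective.ne had) (h.injective.ne hae)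
    rw [IsQuasitrivialSet.pow_mul_of_mul_eq_right this, hS.pow_succ_eq ha]

theorem isNeutral_iff_of_sq_eq (hm : 1 ≤ m) (h : IsMonoidRep F ι) (hF : IsQuasitrivial F)
    {d e : X} (hde : d ≠ e) (h2 : ι d * ι d = ι e * ι e) {a : X} :
    IsNeutral F a ↔ a = d ∨ a = e := by
  constructor
  · intro ha
    by_contra! hne
    have hS := h.isQuasitrivialSet hF
    exact hS.sq_ne_of_sq_eq hm ⟨d, rfl⟩ ⟨e, rfl⟩ (h.injective.ne hde) h2 ⟨a, rfl⟩
      (h.injective.ne hne.1) (h.injective.ne hne.2)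
      (h.sq_eq_of_isNeutral hm hF ha (h.isNeutral_of_sq_eq hm hF hde h2) hne.1)
  · rintro (rfl | rfl)
    · exact h.isNeutral_of_sq_eq hm hF hde h2
    · exact h.isNeutral_of_sq_eq hm hF hde.symm h2.symm

end IsMonoidRep

/-! ### Reduction to a binary operation when squares are distinct -/

/-- The map `f` need not cover `S`: this also serves the complement of a neutral pair. Associativity
holds because both bracketings have the product abc as their cube, and cubes separate points by
`eq_of_pow_eq`. -/
theorem IsQuasitrivialSet.exists_binary {Y M : Type*} [Monoid M] {m : ℕ} {S : Set M} (hm : 1 ≤ m)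
    (hS : IsQuasitrivialSet (m + 1) S) {f : Y → M} (hf : Function.Injective f) (hfS : ∀ a, f a ∈ S)
    (hsq : ∀ a b, f a * f a = f b * f b → a = b) :
    ∃ G : (Fin 2 → Y) → Y, IsAssociative G ∧ IsQuasitrivial G ∧
      ∀ a b, f a * f b = f (G ![a, b]) * f (G ![a, b]) := by
  classical
  have hmul : ∀ a b, f a * f b = f a * f a ∨ f a * f b = f b * f b := by
    intro a b
    rcases hS.mul_eq_or hm (hfS a) (hfS b) with h | h | h
    · exact .inl h
    · exact .inr h
    · exact .inl (by rw [hsq a b h])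
  let G : (Fin 2 → Y) → Y := fun x => if f (x 0) * f (x 1) = f (x 0) * f (x 0) then x 0 else x 1
  have hq : ∀ a b, G ![a, b] = a ∨ G ![a, b] = b := by
    intro a b
    change (if _ then a else b) = a ∨ (if _ then a else b) = b
    split_ifs <;> simp
  have hG : ∀ a b, f a * f b = f (G ![a, b]) * f (G ![a, b]) := by
    intro a b
    change f a * f b = f (if f a * f b = f a * f a then a else b) *
      f (if f a * f b = f a * f a then a else b)
    by_cases h : f a * f b = f a * f a
    · rwa [if_pos h]
    · rw [if_neg h]
      exact (hmul a b).resolve_left h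
  refine ⟨G, isAssociative_two fun a b c => ?_, isQuasitrivial_two hq, hG⟩
  apply hf
  refine hS.eq_of_pow_eq hm (hfS _) (hfS _) (hmul _ _) (i := 2) ?_
  have hl : f a * f b * f c = f (G ![G ![a, b], c]) ^ 3 := by
    rw [hG a b, ← pow_two]
    have h := hG (G ![a, b]) c
    rcases hq (G ![a, b]) c with h' | h' <;> rw [h'] at h ⊢
    · exact pow_mul_of_mul_eq_left h 1
    · exact pow_mul_of_mul_eq_right h 2
  have hr : f a * (f b * f c) = f (G ![a, G ![b, c]]) ^ 3 := by
    rw [hG b c, ← pow_two]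
    have h := hG a (G ![b, c])
    rcases hq a (G ![b, c]) with h' | h' <;> rw [h'] at h ⊢
    · exact mul_pow_of_mul_eq_left h 2
    · exact mul_pow_of_mul_eq_right h 1
  rw [← hl, ← hr, mul_assoc]

theorem IsMonoidRep.exists_eq_iterOp {X M : Type*} [Monoid M] {ι : X → M} {m : ℕ} (hm : 1 ≤ m)
    {F : (Fin (m + 1) → X) → X} (h : IsMonoidRep F ι) (hF : IsQuasitrivial F)
    (hsq : ∀ a b, ι a * ι a = ι b * ι b → a = b) :
    ∃ G : (Fin 2 → X) → X, IsAssociative G ∧ IsQuasitrivial G ∧ F = NaryOp.iterOp m G := by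
  have hS := h.isQuasitrivialSet hF
  obtain ⟨G, hGA, hGQ, hG⟩ := hS.exists_binary hm h.injective Set.mem_range_self hsq
  refine ⟨G, hGA, hGQ, ?_⟩
  -- The exponent counts the letters absorbed so far; after all m + 1 of them the power collapses to
  -- the fold itself.
  have key : ∀ (l : List X) (a : X) (j : ℕ), ι a ^ (j + 1) * (l.map ι).prod =
      ι (l.foldl (fun a b => G ![a, b]) a) ^ (l.length + j + 1) := by
    intro l
    induction l with
    | nil => simp
    | cons b l ih =>
      intro a j
      have h1 : ι a ^ (j + 1) * ι b = ι (G ![a, b]) ^ (j + 1 + 1) := by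
        have h := hG a b
        rcases hGQ.apply_two a b with h' | h' <;> rw [h'] at h ⊢
        · exact IsQuasitrivialSet.pow_mul_of_mul_eq_left h j
        · exact IsQuasitrivialSet.pow_mul_of_mul_eq_right h (j + 1)
      rw [List.map_cons, List.prod_cons, ← mul_assoc, h1, ih, List.foldl_cons, List.length_cons]
      congr 1; ring
  ext x
  apply h.injective
  have := key (List.ofFn (Fin.tail x)) (x 0) 0
  rw [List.length_ofFn, add_zero, hS.pow_succ_eq (Set.mem_range_self _), zero_add, pow_one] at this
  rw [h.map_apply, NaryOp.iterOp, ← this, List.ofFn_succ, List.map_cons, List.prod_cons]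
  rfl

/-- The binary operation `(a, b) ↦ F (a, b, …, b)`. -/
def binaryPart {X : Type*} {m : ℕ} (F : (Fin (m + 1) → X) → X) (a b : X) : X :=
  F (Fin.cons a fun _ => b)

theorem binaryPart_iterOp {X M : Type*} [Monoid M] {ι : X → M} {m : ℕ} (hm : 1 ≤ m)
    {G : (Fin 2 → X) → X} (h : IsMonoidRep G ι) {a b : X} (hb : G ![b, b] = b) :
    binaryPart (iterOp m G) a b = G ![a, b] := by
  apply h.injective
  have hpow : ι b ^ m = ι b := by
    have hbb : ι b * ι b = ι b := by rw [← h.map_apply_two, hb]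
    induction m, hm using Nat.le_induction with
    | base => simp
    | succ j _ ih => rw [pow_succ, ih, hbb]
  rw [binaryPart, (h.iterOp m).map_apply, h.map_apply_two, List.ofFn_cons, List.map_cons,
    List.prod_cons, List.ofFn_const, List.map_replicate, List.prod_replicate, hpow]


/-! ### Extension by a pair of neutral elements -/

variable {Y : Type*}

/-- Extension of a binary operation on `Y` by a two-element group of elements acting as identities
on `Y`. -/
def extOp (H : (Fin 2 → Y) → Y) (x : Fin 2 → Y ⊕ Bool) : Y ⊕ Bool :=
  match x 0, x 1 with
  | .inl a, .inl b => .inl (H ![a, b])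
  | .inl a, .inr _ => .inl a
  | .inr _, .inl b => .inl b
  | .inr c, .inr d => .inr (xor c d)

section

variable (H : (Fin 2 → Y) → Y)

@[simp] theorem extOp_inl_inl (a b : Y) : extOp H ![.inl a, .inl b] = .inl (H ![a, b]) := rfl
@[simp] theorem extOp_inl_inr (a : Y) (d : Bool) : extOp H ![.inl a, .inr d] = .inl a := rfl
@[simp] theorem extOp_inr_inl (c : Bool) (b : Y) : extOp H ![.inr c, .inl b] = .inl b := rfl
@[simp] theorem extOp_inr_inr (c d : Bool) : extOp H ![.inr c, .inr d] = .inr (xor c d) := rfl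

end

theorem IsMonoidRep.assoc {X M : Type*} [Monoid M] {ι : X → M} {G : (Fin 2 → X) → X}
    (h : IsMonoidRep G ι) (a b c : X) : G ![G ![a, b], c] = G ![a, G ![b, c]] :=
  h.injective (by simp only [h.map_apply_two, mul_assoc])

theorem IsAssociative.extOp {Y : Type} {H : (Fin 2 → Y) → Y} (hH : IsAssociative H) :
    IsAssociative (extOp H) := by
  obtain ⟨M, _, ι, h⟩ := hH.exists_isMonoidRep le_rfl
  refine isAssociative_two ?_
  rintro (a | a) (b | b) (c | c) <;> simp [h.assoc]

theorem foldl_extOp_inl {H : (Fin 2 → Y) → Y} (l : List (Y ⊕ Bool)) (a : Y) (d : Bool) :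
    l.foldl (fun a b => extOp H ![a, b]) (.inl a) ≠ .inr d := by
  induction l generalizing a with
  | nil => simp
  | cons b l ih => rcases b with b | b <;> simpa using ih _

theorem foldl_extOp_mem {H : (Fin 2 → Y) → Y} (hH : IsQuasitrivial H) (l : List (Y ⊕ Bool))
    (a : Y ⊕ Bool) (c : Y) (h : l.foldl (fun a b => extOp H ![a, b]) a = .inl c) :
    .inl c ∈ a :: l := by
  induction l generalizing a with
  | nil => simpa using h.symm
  | cons b l ih =>
    have := ih _ h
    rcases a with a | a <;> rcases b with b | b
    · rcases hH.apply_two a b with h' | h' <;>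
        simp only [extOp_inl_inl, h', List.mem_cons] at this ⊢ <;> tauto
    all_goals simp at this ⊢; tauto

theorem foldl_extOp_inr {H : (Fin 2 → Y) → Y} (l : List (Y ⊕ Bool)) (c d : Bool)
    (hl : .inr false ∉ l) (h : l.foldl (fun a b => extOp H ![a, b]) (.inr c) = .inr d) :
    d = xor c l.length.bodd := by
  induction l generalizing c with
  | nil => simpa using h.symm
  | cons b l ih =>
    rw [List.foldl_cons] at h
    rcases b with b | _ | _
    · exact absurd h (foldl_extOp_inl _ _ _)
    · simp at hl
    · have := ih _ (fun h => hl (List.mem_cons_of_mem _ h)) h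
      rw [this]
      simp

theorem foldl_extOp_inr_of_notMem {H : (Fin 2 → Y) → Y} (l : List (Y ⊕ Bool)) (c d : Bool)
    (hl : .inr true ∉ l) (h : l.foldl (fun a b => extOp H ![a, b]) (.inr c) = .inr d) : d = c := by
  induction l generalizing c with
  | nil => simpa using h.symm
  | cons b l ih =>
    rw [List.foldl_cons] at h
    rcases b with b | _ | _
    · exact absurd h (foldl_extOp_inl _ _ _)
    · simpa using ih _ (fun h => hl (List.mem_cons_of_mem _ h)) h
    · simp at hl

/-- Quasitriviality can only fail for words in the two-element group. If only `true` follows the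
first letter, it does so an even number m of times, hence the first letter is returned. -/
theorem isQuasitrivial_iterOp_extOp {m : ℕ} (hm : Even m) {H : (Fin 2 → Y) → Y}
    (hH : IsQuasitrivial H) : IsQuasitrivial (iterOp m (extOp H)) := by
  intro x
  have hx : x 0 :: List.ofFn (Fin.tail x) = List.ofFn x := by rw [List.ofFn_succ]; rfl
  rw [← List.mem_ofFn', ← hx, iterOp]
  have hlen : (List.ofFn (Fin.tail x)).length.bodd = false := by
    rw [List.length_ofFn]
    obtain ⟨t, rfl⟩ := hm
    simp
  generalize x 0 = a at *
  generalize List.ofFn (Fin.tail x) = l at *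
  rcases hr : l.foldl (fun a b => extOp H ![a, b]) a with c | d
  · exact foldl_extOp_mem hH l a c hr
  · rcases a with a | c
    · exact absurd hr (foldl_extOp_inl _ _ _)
    · by_cases hl : .inr false ∈ l
      · cases d
        · exact List.mem_cons_of_mem _ hl
        · by_cases ht : .inr true ∈ l
          · exact List.mem_cons_of_mem _ ht
          · rw [foldl_extOp_inr_of_notMem l c true ht hr]
            exact List.mem_cons_self
      · have := foldl_extOp_inr l c d hl hr
        rw [hlen] at this
        simp [this]

variable {Z : Type} {m : ℕ}

theorem isNeutral_iterOp_extOp_iff (hm : 1 ≤ m) (hme : Even m) {H : (Fin 2 → Z) → Z}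
    (hA : IsAssociative H) (hQ : IsQuasitrivial H) {t : Z ⊕ Bool} :
    IsNeutral (iterOp m (extOp H)) t ↔ t = .inr false ∨ t = .inr true := by
  obtain ⟨M, _, ι, h⟩ := hA.extOp.exists_isMonoidRep le_rfl
  refine (h.iterOp m).isNeutral_iff_of_sq_eq hm (isQuasitrivial_iterOp_extOp hme hQ) (by simp) ?_
  rw [← h.map_apply_two, ← h.map_apply_two]
  rfl

theorem exists_eq_iterOp_extOp (hm : 1 ≤ m) {F : (Fin (m + 1) → Z ⊕ Bool) → Z ⊕ Bool}
    (hA : IsAssociative F) (hQ : IsQuasitrivial F)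
    (hN : ∀ t, IsNeutral F t ↔ t = .inr false ∨ t = .inr true) :
    ∃ H : (Fin 2 → Z) → Z, IsAssociative H ∧ IsQuasitrivial H ∧ F = iterOp m (extOp H) := by
  obtain ⟨M, _, ι, h⟩ := hA.exists_isMonoidRep (by omega)
  have hS := h.isQuasitrivialSet hQ
  have hne : (.inr false : Z ⊕ Bool) ≠ .inr true := by simp
  have h2 := h.sq_eq_of_isNeutral hm hQ ((hN _).2 (.inl rfl)) ((hN _).2 (.inr rfl)) hne
  have hx : ι (.inr false) ∈ Set.range ι := ⟨_, rfl⟩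
  have hy : ι (.inr true) ∈ Set.range ι := ⟨_, rfl⟩
  have hxy := h.injective.ne hne
  obtain ⟨H, hHA, hHQ, hH⟩ := hS.exists_binary hm (f := fun a : Z => ι (.inl a))
    (h.injective.comp Sum.inl_injective) (fun a => ⟨_, rfl⟩) (by
      intro a b hab
      by_contra hne'
      have := h.isNeutral_of_sq_eq hm hQ (fun h => hne' (Sum.inl_injective h)) hab
      simp [hN] at this)
  have hl : ∀ (a : Z) b, ι (.inl a) * ι (.inr b) = ι (.inl a) * ι (.inl a) := by
    intro a b
    have ha : ι (.inl a) ∈ Set.range ι := ⟨_, rfl⟩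
    cases b
    · exact hS.mul_left_eq_of_sq_eq hm hx hy hxy h2 ha (h.injective.ne (by simp))
        (h.injective.ne (by simp))
    · exact hS.mul_left_eq_of_sq_eq hm hy hx hxy.symm h2.symm ha (h.injective.ne (by simp))
        (h.injective.ne (by simp))
  have hr : ∀ (a : Z) b, ι (.inr b) * ι (.inl a) = ι (.inl a) * ι (.inl a) := by
    intro a b
    have ha : ι (.inl a) ∈ Set.range ι := ⟨_, rfl⟩
    cases b
    · exact hS.mul_right_eq_of_sq_eq hm hx hy hxy h2 ha (h.injective.ne (by simp))
        (h.injective.ne (by simp))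
    · exact hS.mul_right_eq_of_sq_eq hm hy hx hxy.symm h2.symm ha (h.injective.ne (by simp))
        (h.injective.ne (by simp))
  have hcomm := hS.comm_of_sq_eq hm hx hy hxy h2
  -- Products in the monoid agree with `extOp` only up to a central factor ι (inr false). An
  -- (m+1)-fold product collects m such factors, which neutrality of `inr false` cancels.
  have hmul : ∀ t u, ι t * ι u = ι (extOp H ![t, u]) * ι (.inr false) := by
    rintro (a | a) (b | b)
    · rw [hH, extOp_inl_inl, hl]
    · rw [hl, extOp_inl_inr, hl]
    · rw [hr, extOp_inr_inl, hl]
    · cases a <;> cases b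
      · rfl
      · exact hcomm
      · rfl
      · exact h2.symm
  have hcen : ∀ t, Commute (ι (.inr false)) (ι t) := by
    rintro (a | _ | _)
    · exact (hr a false).trans (hl a false).symm
    · rfl
    · exact hcomm
  refine ⟨H, hHA, hHQ, ?_⟩
  have key : ∀ (l : List (Z ⊕ Bool)) t, ι t * (l.map ι).prod =
      ι (l.foldl (fun a b => extOp H ![a, b]) t) * ι (.inr false) ^ l.length := by
    intro l
    induction l with
    | nil => simp
    | cons u l ih =>
      intro t
      have hc : Commute (ι (.inr false)) (l.map ι).prod := by
        apply Commute.list_prod_right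
        intro b hb
        obtain ⟨t, -, rfl⟩ := List.mem_map.1 hb
        exact hcen t
      rw [List.map_cons, List.prod_cons, ← mul_assoc, hmul, mul_assoc, hc.eq, ← mul_assoc, ih,
        List.foldl_cons, List.length_cons, pow_succ, mul_assoc]
  ext1 x
  apply h.injective
  have hneu := h.isNeutral_iff.1 ((hN (.inr false)).2 (.inl rfl)) (iterOp m (extOp H) x) 0 m
    (by omega)
  have hk := key (List.ofFn (Fin.tail x)) (x 0)
  rw [List.length_ofFn] at hk
  rw [pow_zero, one_mul] at hneu
  rw [← hneu, iterOp, ← hk, h.map_apply, List.ofFn_succ, List.map_cons, List.prod_cons]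
  rfl


/-! ### The dichotomy and the counts by number of neutral elements -/

variable {X : Type} {m : ℕ}

theorem ncard_le_one_of_set_subsingleton {α : Type*} {s : Set α} (h : s.Subsingleton) :
    s.ncard ≤ 1 := by
  rcases h.eq_empty_or_singleton with rfl | ⟨a, rfl⟩ <;> simp

theorem neutral_dichotomy (hm : 1 ≤ m) {F : (Fin (m + 1) → X) → X} (hA : IsAssociative F)
    (hQ : IsQuasitrivial F) :
    ({e | IsNeutral F e}.Subsingleton ∧
      ∃ G : (Fin 2 → X) → X, IsAssociative G ∧ IsQuasitrivial G ∧ F = iterOp m G) ∨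
    (Even m ∧ ∃ d e, d ≠ e ∧ {e | IsNeutral F e} = {d, e}) := by
  obtain ⟨M, _, ι, h⟩ := hA.exists_isMonoidRep (by omega)
  by_cases hsq : ∀ a b, ι a * ι a = ι b * ι b → a = b
  · refine .inl ⟨fun d hd e he => ?_, h.exists_eq_iterOp hm hQ hsq⟩
    by_contra hde
    exact hde (hsq d e (h.sq_eq_of_isNeutral hm hQ hd he hde))
  · push Not at hsq
    obtain ⟨d, e, h2, hde⟩ := hsq
    refine .inr ⟨(h.isQuasitrivialSet hQ).even_of_sq_eq ⟨d, rfl⟩ ⟨e, rfl⟩ (h.injective.ne hde) h2,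
      d, e, hde, ?_⟩
    ext a
    exact h.isNeutral_iff_of_sq_eq hm hQ hde h2

theorem ncard_neutral_le_two (hm : 1 ≤ m) {F : (Fin (m + 1) → X) → X} (hA : IsAssociative F)
    (hQ : IsQuasitrivial F) : {e | IsNeutral F e}.ncard ≤ 2 := by
  rcases neutral_dichotomy hm hA hQ with ⟨h, -⟩ | ⟨-, d, e, hde, h⟩
  · have := ncard_le_one_of_set_subsingleton h
    omega
  · rw [h, Set.ncard_pair hde]

theorem iterOp_injOn (hm : 1 ≤ m) {G G' : (Fin 2 → X) → X} (hA : IsAssociative G)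
    (hQ : IsQuasitrivial G) (hA' : IsAssociative G') (hQ' : IsQuasitrivial G')
    (h : iterOp m G = iterOp m G') : G = G' := by
  obtain ⟨M, _, ι, hι⟩ := hA.exists_isMonoidRep le_rfl
  obtain ⟨M', _, ι', hι'⟩ := hA'.exists_isMonoidRep le_rfl
  ext x
  have hx : x = ![x 0, x 1] := by ext i; fin_cases i <;> rfl
  rw [hx, ← binaryPart_iterOp hm hι (by simpa using hQ.apply_two (x 1) (x 1)), h,
    binaryPart_iterOp hm hι' (by simpa using hQ'.apply_two (x 1) (x 1))]

theorem IsAssociative.iterOp (m : ℕ) {G : (Fin 2 → X) → X} (hA : IsAssociative G) :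
    IsAssociative (iterOp m G) := by
  obtain ⟨M, _, ι, hι⟩ := hA.exists_isMonoidRep le_rfl
  exact (hι.iterOp m).isAssociative

theorem isNeutral_iterOp_iff (hm : 1 ≤ m) {G : (Fin 2 → X) → X} (hA : IsAssociative G)
    (hQ : IsQuasitrivial G) {e : X} : IsNeutral (iterOp m G) e ↔ IsNeutral G e := by
  obtain ⟨M, _, ι, hι⟩ := hA.exists_isMonoidRep le_rfl
  exact hι.isNeutral_iterOp_iff hm hQ

theorem qNeutral_eq_qNeutral_two (hm : 1 ≤ m) {j : ℕ} (hj : j ≤ 1) (k : ℕ) :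
    qNeutral (m + 1) j k = qNeutral 2 j k := by
  symm
  refine Nat.card_congr (Equiv.ofBijective (fun G => ⟨iterOp m G.1, G.2.1.iterOp m,
    G.2.2.1.iterOp m, ?_⟩) ⟨?_, ?_⟩)
  · simp only [isNeutral_iterOp_iff hm G.2.1 G.2.2.1]
    exact G.2.2.2
  · rintro ⟨G, hA, hQ, _⟩ ⟨G', hA', hQ', _⟩ h
    exact Subtype.ext (iterOp_injOn hm hA hQ hA' hQ' (congrArg Subtype.val h))
  · rintro ⟨F, hA, hQ, hN⟩
    rcases neutral_dichotomy hm hA hQ with ⟨-, G, hGA, hGQ, rfl⟩ | ⟨-, d, e, hde, h⟩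
    · refine ⟨⟨G, hGA, hGQ, ?_⟩, rfl⟩
      simpa only [isNeutral_iterOp_iff hm hGA hGQ] using hN
    · rw [h, Set.ncard_pair hde] at hN
      omega

theorem qNeutral_two_of_odd (hm : 1 ≤ m) (hodd : ¬ Even m) (k : ℕ) : qNeutral (m + 1) 2 k = 0 := by
  rw [qNeutral, Nat.card_eq_zero]
  left
  constructor
  rintro ⟨F, hA, hQ, hN⟩
  rcases neutral_dichotomy hm hA hQ with ⟨h, -⟩ | ⟨h, -⟩
  · have := ncard_le_one_of_set_subsingleton h
    omega
  · exact hodd h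

theorem q_eq_sum_qNeutral (hm : 1 ≤ m) (k : ℕ) :
    q (m + 1) k = qNeutral (m + 1) 0 k + qNeutral (m + 1) 1 k + qNeutral (m + 1) 2 k := by
  classical
  simp only [q, qNeutral, Nat.card_eq_fintype_card, Fintype.card_subtype]
  rw [Finset.card_eq_sum_card_fiberwise (t := Finset.range 3)
    (f := fun F : (Fin (m + 1) → Fin k) → Fin k => {e | IsNeutral F e}.ncard)]
  · simp only [Finset.sum_range_succ, Finset.sum_range_zero, zero_add, Finset.filter_filter,
      and_assoc]
  · intro F hF
    simp only [Finset.coe_filter, Finset.mem_univ, true_and, Set.mem_ofPred_eq] at hF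
    have := ncard_neutral_le_two hm hF.1 hF.2
    simp only [Finset.coe_range, Set.mem_Iio]
    omega

/-! ### Transport along bijections and the count with two neutral elements -/

section conj

variable {T : Type} {n : ℕ}

/-- Transport of an `n`-ary operation along a bijection. -/
def conj (e : X ≃ T) (F : (Fin n → X) → X) (x : Fin n → T) : T := e (F (e.symm ∘ x))

theorem conj_symm_conj (e : X ≃ T) (F : (Fin n → X) → X) : conj e.symm (conj e F) = F := by
  ext1 x
  simp [conj, ← Function.comp_assoc]

theorem IsQuasitrivial.conj {F : (Fin n → X) → X} (h : IsQuasitrivial F) (e : X ≃ T) :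
    IsQuasitrivial (conj e F) := by
  intro x
  obtain ⟨i, hi⟩ := h (e.symm ∘ x)
  exact ⟨i, by simp [NaryOp.conj, ← hi]⟩

theorem IsAssociative.conj (hn : 2 ≤ n) {F : (Fin n → X) → X} (h : IsAssociative F) (e : X ≃ T) :
    IsAssociative (conj e F) := by
  obtain ⟨M, _, ι, hι⟩ := h.exists_isMonoidRep hn
  refine IsMonoidRep.isAssociative (ι := ι ∘ e.symm)
    ⟨hι.injective.comp e.symm.injective, fun x => ?_⟩
  simp [NaryOp.conj, hι.map_apply, List.map_ofFn, Function.comp_assoc]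

theorem isNeutral_conj_iff (e : X ≃ T) {F : (Fin n → X) → X} {t : T} :
    IsNeutral (conj e F) t ↔ IsNeutral F (e.symm t) := by
  have key : ∀ t (a : T) (i : Fin n), e.symm ∘ Function.update (fun _ => t) i a =
      Function.update (fun _ => e.symm t) i (e.symm a) := by
    intro t a i
    rw [Function.comp_update]
    rfl
  constructor
  · intro h a i
    have := h (e a) i
    rw [conj, key, e.symm_apply_apply] at this
    exact e.injective this
  · intro h a i
    rw [conj, key, h, e.apply_symm_apply]

end conj

theorem iterOp_extOp_injOn {Y : Type} (hm : 1 ≤ m) {H H' : (Fin 2 → Y) → Y}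
    (hA : IsAssociative H) (hQ : IsQuasitrivial H) (hA' : IsAssociative H')
    (hQ' : IsQuasitrivial H') (h : iterOp m (extOp H) = iterOp m (extOp H')) : H = H' := by
  obtain ⟨M, _, ι, hι⟩ := hA.extOp.exists_isMonoidRep le_rfl
  obtain ⟨M', _, ι', hι'⟩ := hA'.extOp.exists_isMonoidRep le_rfl
  ext1 x
  have hx : x = ![x 0, x 1] := by ext i; fin_cases i <;> rfl
  apply Sum.inl_injective (β := Bool)
  rw [hx, ← extOp_inl_inl, ← extOp_inl_inl,
    ← binaryPart_iterOp hm hι (by simpa using hQ.apply_two (x 1) (x 1)), h,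
    binaryPart_iterOp hm hι' (by simpa using hQ'.apply_two (x 1) (x 1))]

/-- Labelling the neutral pair by `false` and `true` is part of the fixed `e`. Either labelling
describes every such F, so an unordered pair contributes no factor 2. -/
theorem card_neutral_eq (hm : 1 ≤ m) (hme : Even m) {X Y : Type} (e : X ≃ Y ⊕ Bool) :
    Nat.card {F : (Fin (m + 1) → X) → X // IsAssociative F ∧ IsQuasitrivial F ∧
      ∀ a, IsNeutral F a ↔ e a = .inr false ∨ e a = .inr true} =
    Nat.card {H : (Fin 2 → Y) → Y // IsAssociative H ∧ IsQuasitrivial H} := by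
  symm
  refine Nat.card_congr (Equiv.ofBijective (fun H => ⟨conj e.symm (iterOp m (extOp H.1)),
    (H.2.1.extOp.iterOp m).conj (by omega) _, (isQuasitrivial_iterOp_extOp hme H.2.2).conj _, ?_⟩)
    ⟨?_, ?_⟩)
  · intro a
    rw [isNeutral_conj_iff, isNeutral_iterOp_extOp_iff hm hme H.2.1 H.2.2, Equiv.symm_symm]
  · rintro ⟨H, hA, hQ⟩ ⟨H', hA', hQ'⟩ h
    have h' := congrArg (conj e) (congrArg Subtype.val h)
    have h'' := conj_symm_conj (n := m + 1) e.symm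
    simp only [Equiv.symm_symm] at h''
    simp only [h''] at h'
    exact Subtype.ext (iterOp_extOp_injOn hm hA hQ hA' hQ' h')
  · rintro ⟨F, hA, hQ, hN⟩
    obtain ⟨H, hHA, hHQ, hF⟩ := exists_eq_iterOp_extOp hm (hA.conj (by omega) e) (hQ.conj e)
      (fun t => by rw [isNeutral_conj_iff, hN, e.apply_symm_apply])
    exact ⟨⟨H, hHA, hHQ⟩, Subtype.ext (by simp only [← hF, conj_symm_conj])⟩

theorem exists_equiv_sum_bool {k : ℕ} {s : Finset (Fin k)} (hs : s.card = 2) :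
    ∃ e : Fin k ≃ Fin (k - 2) ⊕ Bool, ∀ a, a ∈ s ↔ e a = .inr false ∨ e a = .inr true := by
  have h1 : Fintype.card {a // ¬ a ∈ s} = Fintype.card (Fin (k - 2)) := by
    rw [Fintype.card_subtype_compl]; simp [hs]
  have h2 : Fintype.card {a // a ∈ s} = Fintype.card Bool := by simp [hs]
  let f₁ := Fintype.equivOfCardEq h1
  let f₂ := Fintype.equivOfCardEq h2
  refine ⟨(Equiv.sumCompl (· ∈ s)).symm.trans ((Equiv.sumComm _ _).trans (f₁.sumCongr f₂)), ?_⟩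
  intro a
  by_cases ha : a ∈ s
  · simp only [ha, true_iff, Equiv.trans_apply, Equiv.sumCompl_symm_apply_of_pos ha]
    simp
  · simp [ha, Equiv.sumCompl_symm_apply_of_neg]

/-- Fibre the operations over their set of neutral elements; each two-element set contributes q 2 (k
− 2). The parity is that of m, so n is odd here. -/
theorem qNeutral_two_of_even (hm : 1 ≤ m) (hme : Even m) (k : ℕ) :
    qNeutral (m + 1) 2 k = Nat.choose k 2 * q 2 (k - 2) := by
  classical
  let N : ((Fin (m + 1) → Fin k) → Fin k) → Finset (Fin k) :=
    fun F => Finset.univ.filter (IsNeutral F)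
  have hN : ∀ F, {e | IsNeutral F e}.ncard = (N F).card := by
    intro F
    rw [← Set.ncard_coe_finset]
    congr 1
    ext; simp [N]
  have key : ∀ s ∈ Finset.powersetCard 2 (Finset.univ : Finset (Fin k)),
      (Finset.univ.filter fun F : (Fin (m + 1) → Fin k) → Fin k =>
        (IsAssociative F ∧ IsQuasitrivial F ∧ {e | IsNeutral F e}.ncard = 2) ∧ N F = s).card =
      q 2 (k - 2) := by
    intro s hs
    have hs := (Finset.mem_powersetCard.1 hs).2
    obtain ⟨e, he⟩ := exists_equiv_sum_bool hs
    rw [q, ← card_neutral_eq hm hme e, Nat.card_eq_fintype_card, Fintype.card_subtype]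
    congr 1
    ext F
    simp only [Finset.mem_filter, Finset.mem_univ, true_and, hN, ← he]
    constructor
    · rintro ⟨⟨hA, hQ, -⟩, rfl⟩
      exact ⟨hA, hQ, fun a => by simp [N]⟩
    · rintro ⟨hA, hQ, h⟩
      have : N F = s := by ext a; simp [N, h]
      exact ⟨⟨hA, hQ, by rw [this, hs]⟩, this⟩
  rw [qNeutral, Nat.card_eq_fintype_card, Fintype.card_subtype,
    Finset.card_eq_sum_card_fiberwise (f := N)
      (t := Finset.powersetCard 2 (Finset.univ : Finset (Fin k)))]
  · simp only [Finset.filter_filter]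
    rw [Finset.sum_congr rfl key, Finset.sum_const, Finset.card_powersetCard, Finset.card_univ,
      Fintype.card_fin, smul_eq_mul]
  · intro F hF
    simp only [Finset.coe_filter, Finset.mem_univ, true_and, Set.mem_ofPred_eq, hN] at hF
    exact Finset.mem_coe.2 (Finset.mem_powersetCard.2 ⟨Finset.subset_univ _, hF.2.2⟩)

end NaryOp

theorem proposition3p16 (n : ℕ) (hn : 2 ≤ n) :
    (∀ k : ℕ, 1 ≤ k →
      NaryOp.qNeutral n 1 k = NaryOp.qNeutral 2 1 k ∧
      (NaryOp.qNeutral n 0 k : ℤ) = (NaryOp.q 2 k : ℤ) - (NaryOp.qNeutral 2 1 k : ℤ)) ∧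
    (∀ k : ℕ, 2 ≤ k →
      (Even n → NaryOp.qNeutral n 2 k = 0) ∧
      (Odd n → NaryOp.qNeutral n 2 k = Nat.choose k 2 * NaryOp.q 2 (k - 2)) ∧
      (Even n → NaryOp.q n k = NaryOp.q 2 k) ∧
      (Odd n → NaryOp.q n k = NaryOp.q 2 k + Nat.choose k 2 * NaryOp.q 2 (k - 2))) := by
  obtain ⟨m, rfl⟩ : ∃ m, n = m + 1 := ⟨n - 1, by omega⟩
  have hm : 1 ≤ m := by omega
  have h0 := NaryOp.qNeutral_eq_qNeutral_two hm (j := 0) (by omega)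
  have h1 := NaryOp.qNeutral_eq_qNeutral_two hm (j := 1) le_rfl
  have hq := NaryOp.q_eq_sum_qNeutral hm
  -- The case m = 1 is odd, so no binary operation being counted has two neutral elements.
  have hq2 : ∀ k, NaryOp.q 2 k = NaryOp.qNeutral 2 0 k + NaryOp.qNeutral 2 1 k := by
    intro k
    have := NaryOp.qNeutral_two_of_odd le_rfl (by simp) k
    have := NaryOp.q_eq_sum_qNeutral le_rfl k
    simp only [Nat.reduceAdd] at *
    omega
  have heven : ∀ k, Even (m + 1) → NaryOp.qNeutral (m + 1) 2 k = 0 := fun k h =>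
    NaryOp.qNeutral_two_of_odd hm (Nat.even_add_one.1 h) k
  have hodd : ∀ k, Odd (m + 1) →
      NaryOp.qNeutral (m + 1) 2 k = Nat.choose k 2 * NaryOp.q 2 (k - 2) := fun k h =>
    NaryOp.qNeutral_two_of_even hm (by rcases h with ⟨t, ht⟩; exact ⟨t, by omega⟩) k
  refine ⟨fun k _ => ⟨h1 k, ?_⟩, fun k _ => ⟨heven k, hodd k, fun h => ?_, fun h => ?_⟩⟩
  · rw [h0, hq2]; push_cast; ring
  · rw [hq, h0, h1, heven k h, hq2]; ring
  · rw [hq, h0, h1, hodd k h, hq2 k]
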